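/- Let $n,d\in\mathbb{N}$ with $0<d<n$. Balls $B(x,r)$ are open. $\mathcal{H}^d$ is $d$-dimensional Hausdorff measure on $\mathbb{R}^n$, normalized so that $\mathcal{H}^d(B(x,r)\cap P)=r^d$ for every $d$-plane $P$, $x\in P$ and $r>0$. $G(n,d)$ is the set of $d$-dimensional linear subspaces of $\mathbb{R}^n$, and $\pi_V$ is the orthogonal projection onto $V$. A closed set $E\subset\mathbb{R}^n$ is lower (resp. upper) $d$-Ahlfors regular with constant $C>0$ if $\mathcal{H}^d(E\cap B(x,r))\ge C^{-1}r^d$ (resp. $\le Cr^d$) for all $x\in E$ and $r>0$. It is $d$-rectifiable if $\mathcal{H}^d$-almost all of it is covered by countably many Lipschitz images of $\mathbb{R}^d$. If $E$ is $d$-rectifiable and upper $d$-Ahlfors regular, then for $\mathcal{H}^d$-almost every $x\in E$ it has an approximate tangent plane $T(x)\in G(n,d)$: the unique plane with $r^{-d}(\Phi_{x,r})_*(\mathcal{H}^d|_E)\rightharpoonup\mathcal{H}^d|_{T(x)}$ as $r\downarrow0$, tested against continuous compactly supported functions, where $\Phi_{x,r}(y)=(y-x)/r$. Set $$\gamma(E)=\sup_{x\in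 E,\,r>0}\ \inf_{V\in G(n,d)}\left(\frac{1}{\mathcal{H}^d(E\cap B(x,r))}\int_{E\cap B(x,r)}\|\pi_{T(y)}-\pi_V\|\,d\mathcal{H}^d(y)+\sup_{y\in E\cap B(x,r)}\frac{|\pi_{V^\perp}(y-x)|}{r}\right).$$ A $d$-dimensional Lipschitz graph with constant $\le\epsilon$ is a set $\{v+A(v):v\in V\}$ with $V\in G(n,d)$ and $A:V\to V^\perp$ $\epsilon$-Lipschitz. A closed set $E$ is $\epsilon$-UR (of dimension $d$) if $0<\epsilon<1/10$ and for every $x\in E$ and $r>0$ there is a $d$-dimensional Lipschitz graph $\Gamma$ with constant $\le\epsilon$ such that $\mathcal{H}^d(B(x,r)\cap(E\,\Delta\,\Gamma))\le\epsilon r^d$ and $\Gamma\cap B(x,r/2)\neq\emptyset$. **Theorem.** For every $C_E>0$ there are constants $\delta_0,C_0>0$, depending only on $n$, $d$ and $C_E$, such that the following holds. Let $0<\delta<\delta_0$, and let $E\subset\mathbb{R}^n$ be closed, $d$-rectifiable, lower $d$-Ahlfors regular with constant $1+\delta$ and upper $d$-Ahlfors regular with constant $C_E$. If $\gamma(E)\le\delta$,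 then $E$ is $(C_0\delta^{1/2})$-UR. -/

import Mathlib

open MeasureTheory Set Filter Topology
open scoped NNReal ENNReal symmDiff

noncomputable section

namespace SmallUR

/-- The Hausdorff measure `ℋ^d` on `ℝⁿ`, normalized so that `ℋ^d (B(x, r) ∩ P) = r ^ d` for every
`d`-plane `P`, every `x ∈ P` and every `r > 0`: Mathlib's measure `μH[d]` divided by its value on
the unit ball of `ℝ^d`. -/
def hausdorff {n : ℕ} (d : ℕ) : Measure (EuclideanSpace ℝ (Fin n)) :=
  (μH[d] (Metric.ball (0 : EuclideanSpace ℝ (Fin d)) 1))⁻¹ • μH[d]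

/-- `E` is lower `d`-Ahlfors regular with constant `C`. -/
def IsLowerAhlforsRegular {n : ℕ} (d : ℕ) (C : ℝ) (E : Set (EuclideanSpace ℝ (Fin n))) : Prop :=
  ∀ x ∈ E, ∀ r : ℝ, 0 < r →
    ENNReal.ofReal (C⁻¹ * r ^ d) ≤ (hausdorff d).restrict E (Metric.ball x r)

/-- `E` is upper `d`-Ahlfors regular with constant `C`. -/
def IsUpperAhlforsRegular {n : ℕ} (d : ℕ) (C : ℝ) (E : Set (EuclideanSpace ℝ (Fin n))) : Prop :=
  ∀ x ∈ E, ∀ r : ℝ, 0 < r →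
    (hausdorff d).restrict E (Metric.ball x r) ≤ ENNReal.ofReal (C * r ^ d)

/-- `E` is `d`-rectifiable: up to an `ℋ^d`-null set it is covered by countably many Lipschitz
images of `ℝ^d`. -/
def IsRectifiable {n : ℕ} (d : ℕ) (E : Set (EuclideanSpace ℝ (Fin n))) : Prop :=
  ∃ f : ℕ → EuclideanSpace ℝ (Fin d) → EuclideanSpace ℝ (Fin n),
    (∀ i, ∃ K : ℝ≥0, LipschitzWith K (f i)) ∧ hausdorff d (E \ ⋃ i, range (f i)) = 0

/-- `V ∈ G(n, d)` is the approximate tangent `d`-plane to `E` at `x`: with `Φ_{x,r}(y) = (y - x)/r`,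
the measures `r^{-d} (Φ_{x,r})_* (ℋ^d|_E)` converge to `ℋ^d|_V`, tested against continuous
functions with compact support, as `r ↓ 0`. -/
def IsApproxTangent {n : ℕ} (d : ℕ) (E : Set (EuclideanSpace ℝ (Fin n)))
    (x : EuclideanSpace ℝ (Fin n)) (V : Submodule ℝ (EuclideanSpace ℝ (Fin n))) : Prop :=
  Module.finrank ℝ V = d ∧
    ∀ φ : EuclideanSpace ℝ (Fin n) → ℝ, Continuous φ → HasCompactSupport φ →
      Tendsto
        (fun r : ℝ => ∫ z, φ z ∂(ENNReal.ofReal ((r ^ d)⁻¹) •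
          ((hausdorff d).restrict E).map (fun y => r⁻¹ • (y - x))))
        (𝓝[>] 0) (𝓝 (∫ z, φ z ∂((hausdorff d).restrict (V : Set (EuclideanSpace ℝ (Fin n))))))

open Classical in
/-- The approximate tangent `d`-plane `T(x)` to `E` at `x`. It is unique where it exists, which for
a `d`-rectifiable set of locally finite measure is `ℋ^d`-almost everywhere on `E`; at the other
points the value is irrelevant. -/
def approxTangent {n : ℕ} (d : ℕ) (E : Set (EuclideanSpace ℝ (Fin n)))
    (x : EuclideanSpace ℝ (Fin n)) : Submodule ℝ (EuclideanSpace ℝ (Fin n)) :=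
  if h : ∃ V, IsApproxTangent d E x V then h.choose else ⊥

/-- The quantity `γ(E)`, the supremum over `x ∈ E` and `r > 0` of the infimum over `V ∈ G(n, d)` of
`⨍_{B(x,r)} ‖π_{T(y)} - π_V‖ dℋ^d|_E(y) + sup_{y ∈ B(x,r) ∩ E} |π_{V^⊥}(y - x)| / r`. -/
def gamma {n : ℕ} (d : ℕ) (E : Set (EuclideanSpace ℝ (Fin n))) : ℝ≥0∞ :=
  ⨆ x ∈ E, ⨆ r : ℝ, ⨆ _ : 0 < r,
    ⨅ V : Submodule ℝ (EuclideanSpace ℝ (Fin n)), ⨅ _ : Module.finrank ℝ V = d,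
      (⨍⁻ y in Metric.ball x r,
          ENNReal.ofReal ‖(approxTangent d E y).starProjection - V.starProjection‖
            ∂((hausdorff d).restrict E)) +
        ⨆ y ∈ Metric.ball x r ∩ E, ENNReal.ofReal (‖Vᗮ.starProjection (y - x)‖ / r)

/-- `Γ` is a `d`-dimensional Lipschitz graph with constant at most `L`: the graph
`{v + A v : v ∈ V}` of an `L`-Lipschitz map `A : V → V^⊥` over some `V ∈ G(n, d)`. -/
def IsLipschitzGraph {n : ℕ} (d : ℕ) (L : ℝ) (Γ : Set (EuclideanSpace ℝ (Fin n))) : Prop :=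
  ∃ V : Submodule ℝ (EuclideanSpace ℝ (Fin n)), Module.finrank ℝ V = d ∧
    ∃ A : V → Vᗮ, (∀ v w : V, ‖A v - A w‖ ≤ L * ‖v - w‖) ∧
      Γ = range fun v : V => (v : EuclideanSpace ℝ (Fin n)) + (A v : EuclideanSpace ℝ (Fin n))

/-- The closed set `E` is `δ`-uniformly rectifiable of dimension `d`. -/
def IsSmallUR {n : ℕ} (d : ℕ) (δ : ℝ) (E : Set (EuclideanSpace ℝ (Fin n))) : Prop :=
  IsClosed E ∧ 0 < δ ∧ δ < 1 / 10 ∧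
    ∀ x ∈ E, ∀ r : ℝ, 0 < r → ∃ Γ : Set (EuclideanSpace ℝ (Fin n)), IsLipschitzGraph d δ Γ ∧
      (hausdorff d).restrict (Metric.ball x r) (E ∆ Γ) ≤ ENNReal.ofReal (δ * r ^ d) ∧
      (Γ ∩ Metric.ball x (r / 2)).Nonempty

end SmallUR

end

/-!
Write `δ = s ^ 2`, and let `B(x, r)` be a ball centred on `E`. Let `V` be a plane that is almost
optimal for `gamma` in `B(x, 6r)`, so that the tangent planes of `E` are within `2 s ^ 2` of `V` on
average there. By the maximal function estimate `mul_measure_le_of_forall_exists_ball`, off a set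
of measure at most a multiple of `s r ^ d` the average distance of the tangent planes to `V` is at
most `s` on every smaller ball `B(y, ρ)`. The plane `W` that `gamma` provides for `B(y, ρ)` is then
within `3 s` of `V`, and `E ∩ B(y, ρ)` is within `2 s ^ 2 ρ` of `y + W`. Hence the chords of the
remaining set `F` make an angle of order `s` with `V` (`exists_plane_chords`), and `F` lies on a
Lipschitz graph `Γ` over `V` with constant of order `s` (`exists_subset_range_graph`).

So `E \ Γ` has measure of order `s r ^ d` in `B(x, r)`. For `Γ \ E`, note that `Γ` has measure at
most `(1 + O(s)) r ^ d` in `B(x, r)` (`hausdorff_graph_inter_ball_le`), whereas `E` has measure at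
least `r ^ d / (1 + δ)`: the two nearly agree, and `E` is mostly contained in `Γ`
(`measure_symmDiff_le`). The lower regularity also forces `F` to meet `B(x, r / 2)`.

The comparison of `V` with `W` integrates the triangle inequality, which for lower integrals needs
a measurable integrand. Where an approximate tangent plane exists, its projection is a limit of
rescaled second moments of `ℋ^d` on `E`, hence agrees with a Borel field `M`
(`exists_measurable_eq_starProjection`). Where none exists, the value `⊥` of `approxTangent` is at
distance `1` from every `d`-plane. Thus `min 1 ‖M - π_V‖` is Borel and at most `‖π_T - π_V‖`
everywhere, which is all that is used; in particular the existence of tangent planes almost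
everywhere plays no role.
-/

namespace SmallUR

open scoped RealInnerProductSpace

variable {n d : ℕ}

/-! ### Hausdorff measure on planes -/

/-- Mathlib's instance is stated for the exponent `finrank ℝ E`, which instance search does not
unify with `d`. -/
instance isAddHaarMeasure_hausdorffMeasure_self :
    (μH[d] : Measure (EuclideanSpace ℝ (Fin d))).IsAddHaarMeasure := by
  simpa using isAddHaarMeasure_hausdorffMeasure (E := EuclideanSpace ℝ (Fin d))

instance isAddHaarMeasure_hausdorff_self :
    (hausdorff (n := d) d).IsAddHaarMeasure :=
  .smul _ (ENNReal.inv_ne_zero.2 Metric.isBounded_ball.measure_lt_top.ne)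
    (ENNReal.inv_ne_top.2 (Metric.isOpen_ball.measure_pos _ ⟨0, by simp⟩).ne')

lemma hausdorff_ball_self (x : EuclideanSpace ℝ (Fin d)) {r : ℝ} (hr : 0 < r) :
    hausdorff d (Metric.ball x r) = ENNReal.ofReal (r ^ d) := by
  have h1 : hausdorff d (Metric.ball (0 : EuclideanSpace ℝ (Fin d)) 1) = 1 := by
    simp only [hausdorff, Measure.smul_apply, smul_eq_mul]
    exact ENNReal.inv_mul_cancel (Metric.isOpen_ball.measure_pos _ ⟨0, by simp⟩).ne'
      Metric.isBounded_ball.measure_lt_top.ne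
  have := Measure.addHaar_ball_of_pos (hausdorff (n := d) d) x hr
  rw [h1] at this
  simpa using this

lemma map_hausdorff_eq_restrict (ι : EuclideanSpace ℝ (Fin d) →ₗᵢ[ℝ] EuclideanSpace ℝ (Fin n)) :
    (hausdorff d).map ι = (hausdorff d).restrict (range ι) := by
  simp only [hausdorff, Measure.map_smul, Measure.restrict_smul]
  rw [ι.isometry.map_hausdorffMeasure (Or.inl (by positivity))]

lemma exists_linearIsometry_range_eq {V : Submodule ℝ (EuclideanSpace ℝ (Fin n))}
    (hV : Module.finrank ℝ V = d) :
    ∃ ι : EuclideanSpace ℝ (Fin d) →ₗᵢ[ℝ] EuclideanSpace ℝ (Fin n), range ι = V := by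
  let b := (stdOrthonormalBasis ℝ V).reindex (finCongr hV)
  refine ⟨V.subtypeₗᵢ.comp b.repr.symm.toLinearIsometry, ?_⟩
  ext z
  constructor
  · rintro ⟨u, rfl⟩
    exact (b.repr.symm u).2
  · intro hz
    exact ⟨b.repr ⟨z, hz⟩, by simp⟩

/-! ### Second moments of Hausdorff measure on a plane -/

/-- The cutoff `max 0 (1 - |z|)`: rotation invariant and compactly supported, it makes second
moments admissible test functions for approximate tangent planes. -/
noncomputable def tent (z : EuclideanSpace ℝ (Fin n)) : ℝ := max 0 (1 - ‖z‖)

lemma continuous_tent : Continuous (tent (n := n)) := by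
  unfold tent; fun_prop

lemma hasCompactSupport_tent : HasCompactSupport (tent (n := n)) := by
  refine HasCompactSupport.intro (isCompact_closedBall 0 1) fun z hz => ?_
  simp only [Metric.mem_closedBall, dist_zero_right, not_le] at hz
  exact max_eq_left (by linarith)

lemma continuous_moment (a b : EuclideanSpace ℝ (Fin n)) :
    Continuous fun z : EuclideanSpace ℝ (Fin n) => ⟪z, a⟫ * ⟪z, b⟫ * tent z := by
  have := continuous_tent (n := n)
  fun_prop

lemma hasCompactSupport_moment (a b : EuclideanSpace ℝ (Fin n)) :
    HasCompactSupport fun z : EuclideanSpace ℝ (Fin n) => ⟪z, a⟫ * ⟪z, b⟫ * tent z :=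
  hasCompactSupport_tent.mul_left

/-- By rotation invariance, the weighted second moments of `ℋ^d` on `ℝ^d` are a positive multiple
of the inner product. -/
lemma exists_integral_moment_self (hd : 0 < d) :
    ∃ c : ℝ, 0 < c ∧ ∀ a b : EuclideanSpace ℝ (Fin d),
      ∫ u, ⟪u, a⟫ * ⟪u, b⟫ * tent u ∂(hausdorff d) = c * ⟪a, b⟫ := by
  set q : EuclideanSpace ℝ (Fin d) → ℝ := fun a => ∫ u, ⟪u, a⟫ * ⟪u, a⟫ * tent u ∂(hausdorff d)
    with hq
  have hint (a b : EuclideanSpace ℝ (Fin d)) :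
      Integrable (fun u => ⟪u, a⟫ * ⟪u, b⟫ * tent u) (hausdorff d) :=
    (continuous_moment a b).integrable_of_hasCompactSupport (hasCompactSupport_moment a b)
  -- `q` depends on the norm only, because a reflection exchanges any two vectors of equal norm
  have hrot {a b : EuclideanSpace ℝ (Fin d)} (hab : ‖a‖ = ‖b‖) : q a = q b := by
    set R := (ℝ ∙ (a - b))ᗮ.reflection
    have hR : R a = b := Submodule.reflection_sub hab
    have hmp : MeasurePreserving R (hausdorff d) (hausdorff d) := by
      refine ⟨R.continuous.measurable, ?_⟩
      have := map_hausdorff_eq_restrict R.toLinearIsometry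
      simpa [R.surjective.range_eq] using this
    have := hmp.integral_comp R.toHomeomorph.measurableEmbedding
      (fun u => ⟪u, b⟫ * ⟪u, b⟫ * tent u)
    rw [hq]
    simp only
    rw [← this]
    refine integral_congr_ae (Eventually.of_forall fun u => ?_)
    simp only [← hR, LinearIsometryEquiv.inner_map_map, tent, LinearIsometryEquiv.norm_map]
  have hsmul (t : ℝ) (a : EuclideanSpace ℝ (Fin d)) : q (t • a) = t ^ 2 * q a := by
    simp only [hq, ← integral_const_mul]
    refine integral_congr_ae (Eventually.of_forall fun u => ?_)
    simp only [inner_smul_right]; ring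
  let e : EuclideanSpace ℝ (Fin d) := EuclideanSpace.single ⟨0, hd⟩ 1
  have he : ‖e‖ = 1 := by simp [e]
  have hqn (a : EuclideanSpace ℝ (Fin d)) : q a = q e * ⟪a, a⟫ := by
    have : q a = q (‖a‖ • e) := hrot (by simp [norm_smul, he])
    rw [this, hsmul, real_inner_self_eq_norm_sq]; ring
  refine ⟨q e, ?_, fun a b => ?_⟩
  · refine (continuous_moment e e).integral_pos_of_hasCompactSupport_nonneg_nonzero
      (hasCompactSupport_moment e e) (fun u => ?_) (x := (1 / 2 : ℝ) • e) ?_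
    · exact mul_nonneg (mul_self_nonneg _) (le_max_left _ _)
    · simp [inner_smul_left, tent, norm_smul, he]
      norm_num
  · -- polarization
    have h1 : q (a + b) = q a + 2 * ∫ u, ⟪u, a⟫ * ⟪u, b⟫ * tent u ∂(hausdorff d) + q b := by
      simp only [hq]
      have hab : Integrable (fun u => ⟪u, a⟫ * ⟪u, a⟫ * tent u + 2 * (⟪u, a⟫ * ⟪u, b⟫ * tent u))
        (hausdorff d) := (hint a a).add ((hint a b).const_mul 2)
      rw [← integral_const_mul, ← integral_add (hint a a) ((hint a b).const_mul 2),
        ← integral_add hab (hint b b)]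
      refine integral_congr_ae (Eventually.of_forall fun u => ?_)
      simp only [inner_add_right]; ring
    have h2 := hqn (a + b)
    rw [h1, hqn a, hqn b, real_inner_add_add_self] at h2
    linarith

/-- The second moments of `ℋ^d` on a `d`-plane determine the orthogonal projection onto it. -/
lemma exists_integral_moment (n : ℕ) (hd : 0 < d) :
    ∃ c : ℝ, 0 < c ∧ ∀ V : Submodule ℝ (EuclideanSpace ℝ (Fin n)), Module.finrank ℝ V = d →
      ∀ a b : EuclideanSpace ℝ (Fin n),
        ∫ z, ⟪z, a⟫ * ⟪z, b⟫ * tent z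
          ∂((hausdorff d).restrict (V : Set (EuclideanSpace ℝ (Fin n))))
          = c * ⟪V.starProjection a, b⟫ := by
  obtain ⟨c, hc, h⟩ := exists_integral_moment_self hd
  refine ⟨c, hc, fun V hV a b => ?_⟩
  obtain ⟨ι, hι⟩ := exists_linearIsometry_range_eq hV
  have hmem (a : EuclideanSpace ℝ (Fin n)) : ∃ a', ι a' = V.starProjection a := by
    have : V.starProjection a ∈ range ι := by rw [hι]; exact V.starProjection_apply_mem a
    exact this
  have hin (u) {a a'} (ha : ι a' = V.starProjection a) : ⟪ι u, a⟫ = ⟪u, a'⟫ := by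
    have hu : ι u ∈ V := by rw [← SetLike.mem_coe, ← hι]; exact mem_range_self u
    rw [← ι.inner_map_map, ha, ← Submodule.inner_starProjection_left_eq_right,
      Submodule.starProjection_eq_self_iff.2 hu]
  obtain ⟨a', ha⟩ := hmem a
  obtain ⟨b', hb⟩ := hmem b
  rw [← hι, ← map_hausdorff_eq_restrict,
    ι.isometry.isClosedEmbedding.measurableEmbedding.integral_map]
  simp only [hin _ ha, hin _ hb, tent, LinearIsometry.norm_map]
  have := h a' b'
  simp only [tent] at this
  rw [this, ← ha, hin _ hb]

/-! ### Measurability of the tangent plane field -/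

lemma stronglyMeasurable_integral_map_rescale (μ : Measure (EuclideanSpace ℝ (Fin n))) [SFinite μ]
    {φ : EuclideanSpace ℝ (Fin n) → ℝ} (hφ : Continuous φ) (t : ℝ) :
    StronglyMeasurable fun y => ∫ z, φ z ∂(μ.map fun z => t • (z - y)) := by
  have h (y : EuclideanSpace ℝ (Fin n)) :
      ∫ z, φ z ∂(μ.map fun z => t • (z - y)) = ∫ z, φ (t • (z - y)) ∂μ :=
    integral_map (by fun_prop) hφ.aestronglyMeasurable
  simp only [h]
  have hc : Continuous
      (Function.uncurry fun y z : EuclideanSpace ℝ (Fin n) => φ (t • (z - y))) := by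
    unfold Function.uncurry
    fun_prop
  exact hc.stronglyMeasurable.integral_prod_right

/-- The approximate tangent plane, where it exists, is given by a Borel field of operators:
the entries of its projection are limits of rescaled second moments. -/
lemma exists_measurable_eq_starProjection (hd : 0 < d) (E : Set (EuclideanSpace ℝ (Fin n)))
    [SFinite ((hausdorff d).restrict E)] :
    ∃ M : EuclideanSpace ℝ (Fin n) → EuclideanSpace ℝ (Fin n) →L[ℝ] EuclideanSpace ℝ (Fin n),
      Measurable M ∧ ∀ y V, IsApproxTangent d E y V → M y = V.starProjection := by
  obtain ⟨c, hc, hmom⟩ := exists_integral_moment n hd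
  let e := EuclideanSpace.basisFun (Fin n) ℝ
  let F (i j : Fin n) (k : ℕ) (y : EuclideanSpace ℝ (Fin n)) : ℝ :=
    ∫ z, ⟪z, e i⟫ * ⟪z, e j⟫ * tent z
      ∂(ENNReal.ofReal (((1 / ((k : ℝ) + 1)) ^ d)⁻¹) •
          ((hausdorff d).restrict E).map (fun z => (1 / ((k : ℝ) + 1))⁻¹ • (z - y)))
  have hF (i j : Fin n) (k : ℕ) : StronglyMeasurable (F i j k) := by
    simp only [F, integral_smul_measure, smul_eq_mul]
    refine StronglyMeasurable.const_mul ?_ _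
    exact stronglyMeasurable_integral_map_rescale _ (continuous_moment _ _) _
  let m (i j : Fin n) (y : EuclideanSpace ℝ (Fin n)) : ℝ := limUnder atTop fun k => F i j k y
  have hm (i j : Fin n) : Measurable (m i j) := (StronglyMeasurable.limUnder (hF i j)).measurable
  refine ⟨fun y => ∑ i, ∑ j, (c⁻¹ * m i j y) • (innerSL ℝ (e i)).smulRight (e j), ?_, ?_⟩
  · refine Finset.measurable_sum _ fun i _ => Finset.measurable_sum _ fun j _ => ?_
    exact ((hm i j).const_mul _).smul_const _
  · intro y V hV
    have hlim (i j : Fin n) : m i j y = c * ⟪V.starProjection (e i), e j⟫ := by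
      rw [← hmom V hV.1]
      refine Tendsto.limUnder_eq ?_
      have h0 : Tendsto (fun k : ℕ => 1 / ((k : ℝ) + 1)) atTop (𝓝[>] 0) :=
        tendsto_nhdsWithin_iff.2 ⟨tendsto_one_div_add_atTop_nhds_zero_nat,
          Eventually.of_forall fun k => by simp only [mem_Ioi]; positivity⟩
      exact (hV.2 _ (continuous_moment (e i) (e j)) (hasCompactSupport_moment _ _)).comp h0
    ext1 z
    simp only [hlim, inv_mul_cancel_left₀ hc.ne', sum_apply,
      smul_apply, ContinuousLinearMap.smulRight_apply, innerSL_apply_apply]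
    conv_rhs => rw [← e.sum_repr z, map_sum]
    refine Finset.sum_congr rfl fun i _ => ?_
    rw [map_smul]
    conv_rhs => rw [← e.sum_repr (V.starProjection (e i)), Finset.smul_sum]
    refine Finset.sum_congr rfl fun j _ => ?_
    rw [smul_smul, smul_smul, e.repr_apply_apply, e.repr_apply_apply, real_inner_comm (e j),
      mul_comm]

/-! ### A maximal function estimate -/

/-- Weak-type estimate for the maximal function of a measure that is doubling at the points of `S`;
`g` need not be measurable. -/
lemma mul_measure_le_of_forall_exists_ball {X : Type*} [PseudoMetricSpace X]
    [SecondCountableTopology X] [MeasurableSpace X] [OpensMeasurableSpace X] {μ : Measure X}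
    {g : X → ℝ≥0∞} {S U : Set X} {R : ℝ} {t K : ℝ≥0∞}
    (hK : ∀ y ∈ S, ∀ ρ, 0 < ρ → μ (Metric.ball y (4 * ρ)) ≤ K * μ (Metric.ball y ρ))
    (h : ∀ y ∈ S, ∃ ρ, 0 < ρ ∧ ρ ≤ R ∧ Metric.ball y ρ ⊆ U ∧
      t * μ (Metric.ball y ρ) ≤ ∫⁻ z in Metric.ball y ρ, g z ∂μ) :
    t * μ S ≤ K * ∫⁻ z in U, g z ∂μ := by
  choose! ρ hρ0 hρR hρU hρ using h
  obtain ⟨u, huS, hdisj, hcov⟩ := Vitali.exists_disjoint_subfamily_covering_enlargement_ball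
    S id ρ R hρR 4 (by norm_num)
  simp only [id] at hdisj hcov
  have hu : u.Countable := hdisj.countable_of_isOpen (fun _ _ => Metric.isOpen_ball)
    fun y hy => ⟨y, Metric.mem_ball_self (hρ0 y (huS hy))⟩
  have hsub : S ⊆ ⋃ b ∈ u, Metric.ball b (4 * ρ b) := fun y hy => by
    obtain ⟨b, hb, hsub⟩ := hcov y hy
    exact mem_biUnion hb (hsub (Metric.mem_ball_self (hρ0 y hy)))
  calc t * μ S ≤ t * ∑' b : u, μ (Metric.ball (b : X) (4 * ρ b)) := by
        gcongr
        exact (measure_mono hsub).trans (measure_biUnion_le μ hu _)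
    _ ≤ t * ∑' b : u, K * μ (Metric.ball (b : X) (ρ b)) := by
        gcongr with b
        exact hK b (huS b.2) _ (hρ0 b (huS b.2))
    _ = K * ∑' b : u, t * μ (Metric.ball (b : X) (ρ b)) := by
        rw [ENNReal.tsum_mul_left, ENNReal.tsum_mul_left, mul_left_comm]
    _ ≤ K * ∑' b : u, ∫⁻ z in Metric.ball (b : X) (ρ b), g z ∂μ := by
        gcongr with b
        exact hρ b (huS b.2)
    _ = K * ∫⁻ z in ⋃ b ∈ u, Metric.ball b (ρ b), g z ∂μ := by
        rw [lintegral_biUnion hu (fun _ _ => measurableSet_ball) hdisj]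
    _ ≤ K * ∫⁻ z in U, g z ∂μ := by
        gcongr
        exact iUnion₂_subset fun b hb => hρU b (huS hb)

/-! ### Lipschitz graphs -/

lemma hausdorff_image_le {K : ℝ≥0} {f : EuclideanSpace ℝ (Fin d) → EuclideanSpace ℝ (Fin n)}
    (hf : LipschitzWith K f) (s : Set (EuclideanSpace ℝ (Fin d))) :
    hausdorff d (f '' s) ≤ (K : ℝ≥0∞) ^ d * hausdorff d s := by
  simp only [hausdorff, Measure.smul_apply, smul_eq_mul]
  rw [mul_left_comm]
  gcongr
  simpa using hf.hausdorffMeasure_image_le (Nat.cast_nonneg d) s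

/-- A set whose chords are nearly parallel to `V` lies on a Lipschitz graph over `V`, with a
constant that does not depend on `V`. -/
lemma exists_subset_range_graph (n : ℕ) : ∃ K : ℝ, 1 ≤ K ∧
    ∀ (V : Submodule ℝ (EuclideanSpace ℝ (Fin n))) (F : Set (EuclideanSpace ℝ (Fin n))) (η : ℝ),
      0 ≤ η → η ≤ 1 / 2 →
      (∀ y ∈ F, ∀ z ∈ F, ‖Vᗮ.starProjection (z - y)‖ ≤ η * ‖z - y‖) →
      ∃ A : V → Vᗮ, (∀ v w : V, ‖A v - A w‖ ≤ K * η * ‖v - w‖) ∧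
        F ⊆ range fun v : V =>
          (v : EuclideanSpace ℝ (Fin n)) + (A v : EuclideanSpace ℝ (Fin n)) := by
  -- the extension theorem is applied with target `ℝⁿ`, whose constant does not see `V`
  let K₀ := lipschitzExtensionConstant (EuclideanSpace ℝ (Fin n))
  refine ⟨max 1 (2 * K₀), le_max_left _ _, fun V F η hη hη2 hF => ?_⟩
  let P := V.orthogonalProjectionOnto
  have hP (y : EuclideanSpace ℝ (Fin n)) : ((P y : V) : EuclideanSpace ℝ (Fin n)) =
      V.starProjection y := rfl
  have key (y) (hy : y ∈ F) (z) (hz : z ∈ F) :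
      ‖Vᗮ.starProjection z - Vᗮ.starProjection y‖ ≤ 2 * η * ‖P z - P y‖ := by
    have h1 := hF y hy z hz
    have h2 : ‖z - y‖ ≤ ‖P z - P y‖ + ‖Vᗮ.starProjection (z - y)‖ := by
      rw [← map_sub P, Submodule.coe_norm, hP]
      conv_lhs => rw [← V.starProjection_add_starProjection_orthogonal (z - y)]
      exact norm_add_le _ _
    rw [← map_sub]
    have h3 : ‖z - y‖ ≤ 2 * ‖P z - P y‖ := by nlinarith [norm_nonneg (z - y)]
    calc _ ≤ η * ‖z - y‖ := h1
      _ ≤ η * (2 * ‖P z - P y‖) := by gcongr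
      _ = _ := by ring
  let f : V → EuclideanSpace ℝ (Fin n) := fun v => Vᗮ.starProjection (Function.invFunOn P F v)
  have hf : LipschitzOnWith (2 * η).toNNReal f (P '' F) := by
    refine LipschitzOnWith.of_dist_le' fun v hv w hw => ?_
    have := key _ (Function.invFunOn_mem hw) _ (Function.invFunOn_mem hv)
    rw [Function.invFunOn_eq hv, Function.invFunOn_eq hw] at this
    simpa only [dist_eq_norm] using this
  obtain ⟨g, hg, hgf⟩ := hf.extend_finite_dimension
  refine ⟨fun v => Vᗮ.orthogonalProjectionOnto (g v), fun v w => ?_, fun y hy => ⟨P y, ?_⟩⟩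
  · rw [← map_sub]
    calc _ ≤ ‖g v - g w‖ := Vᗮ.norm_orthogonalProjectionOnto_apply_le _
      _ ≤ (K₀ : ℝ) * (2 * η) * ‖v - w‖ := by
          simpa only [dist_eq_norm, NNReal.coe_mul,
            Real.coe_toNNReal (2 * η) (by positivity)] using hg.dist_le_mul v w
      _ = 2 * K₀ * η * ‖v - w‖ := by ring
      _ ≤ _ := by gcongr; exact le_max_right _ _
  · have hy' : P y ∈ P '' F := mem_image_of_mem P hy
    have h1 : g (P y) = Vᗮ.starProjection y := by
      rw [← hgf hy']
      have := key _ hy _ (Function.invFunOn_mem hy')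
      rw [Function.invFunOn_eq hy', sub_self, norm_zero, mul_zero] at this
      exact sub_eq_zero.1 (norm_le_zero_iff.1 this)
    change V.starProjection y + Vᗮ.starProjection (g (P y)) = y
    rw [h1, Submodule.starProjection_eq_self_iff.2 (Vᗮ.starProjection_apply_mem y),
      V.starProjection_add_starProjection_orthogonal]

/-- The part of a Lipschitz graph over `V` in a ball is a Lipschitz image of a ball of `V` of the
same radius. -/
lemma hausdorff_graph_inter_ball_le {V : Submodule ℝ (EuclideanSpace ℝ (Fin n))}
    (hV : Module.finrank ℝ V = d) {ε : ℝ} (hε : 0 ≤ ε) {A : V → Vᗮ}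
    (hA : ∀ v w : V, ‖A v - A w‖ ≤ ε * ‖v - w‖) (x : EuclideanSpace ℝ (Fin n)) {r : ℝ}
    (hr : 0 < r) :
    hausdorff d ((range fun v : V =>
        (v : EuclideanSpace ℝ (Fin n)) + (A v : EuclideanSpace ℝ (Fin n))) ∩ Metric.ball x r) ≤
      ENNReal.ofReal ((1 + ε) ^ d * r ^ d) := by
  let b := ((stdOrthonormalBasis ℝ V).reindex (finCongr hV)).repr
  let f : EuclideanSpace ℝ (Fin d) → EuclideanSpace ℝ (Fin n) := fun u =>
    (b.symm u : EuclideanSpace ℝ (Fin n)) + (A (b.symm u) : EuclideanSpace ℝ (Fin n))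
  have hf : LipschitzWith (1 + ε).toNNReal f := by
    refine LipschitzWith.of_dist_le' fun u w => ?_
    have h1 := hA (b.symm u) (b.symm w)
    rw [← map_sub, b.symm.norm_map] at h1
    have h2 : f u - f w = ((b.symm (u - w) : V) : EuclideanSpace ℝ (Fin n)) +
        ((A (b.symm u) - A (b.symm w) : Vᗮ) : EuclideanSpace ℝ (Fin n)) := by
      simp only [f, map_sub, Submodule.coe_sub]; abel
    rw [dist_eq_norm, dist_eq_norm, h2]
    refine (norm_add_le _ _).trans ?_
    rw [← Submodule.coe_norm, ← Submodule.coe_norm, b.symm.norm_map]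
    linarith
  have hsub : (range fun v : V =>
        (v : EuclideanSpace ℝ (Fin n)) + (A v : EuclideanSpace ℝ (Fin n))) ∩ Metric.ball x r ⊆
      f '' Metric.ball (b (V.orthogonalProjectionOnto x)) r := by
    rintro _ ⟨⟨v, rfl⟩, hv⟩
    refine ⟨b v, ?_, by simp [f]⟩
    rw [Metric.mem_ball, b.dist_map]
    have h1 : V.orthogonalProjectionOnto
        ((v : EuclideanSpace ℝ (Fin n)) + (A v : EuclideanSpace ℝ (Fin n))) = v := by
      rw [map_add, V.orthogonalProjectionOnto_mem_subspace_eq_self,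
        Submodule.orthogonalProjectionOnto_apply_of_mem_orthogonal (A v).2, add_zero]
    rw [← h1, dist_eq_norm, ← map_sub]
    exact (V.norm_orthogonalProjectionOnto_apply_le _).trans_lt (by simpa [dist_eq_norm] using hv)
  refine (measure_mono hsub).trans ((hausdorff_image_le hf _).trans_eq ?_)
  rw [hausdorff_ball_self _ hr, ENNReal.ofReal_mul (by positivity),
    ENNReal.ofReal_pow (by positivity : 0 ≤ 1 + ε)]
  rfl

/-! ### Tilt of the tangent planes -/

/-- A Borel substitute for `‖π_{T(y)} - π_V‖`, truncated so that it also bounds this quantity from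
below where no approximate tangent plane exists. -/
noncomputable def truncatedTilt
    (M : EuclideanSpace ℝ (Fin n) → EuclideanSpace ℝ (Fin n) →L[ℝ] EuclideanSpace ℝ (Fin n))
    (V : Submodule ℝ (EuclideanSpace ℝ (Fin n))) (y : EuclideanSpace ℝ (Fin n)) : ℝ≥0∞ :=
  ENNReal.ofReal (min 1 ‖M y - V.starProjection‖)

lemma measurable_truncatedTilt
    {M : EuclideanSpace ℝ (Fin n) → EuclideanSpace ℝ (Fin n) →L[ℝ] EuclideanSpace ℝ (Fin n)}
    (hM : Measurable M) (V : Submodule ℝ (EuclideanSpace ℝ (Fin n))) :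
    Measurable (truncatedTilt M V) :=
  ENNReal.measurable_ofReal.comp (measurable_const.min (hM.sub_const _).norm)

lemma truncatedTilt_le (hd : 0 < d) {E : Set (EuclideanSpace ℝ (Fin n))}
    {M : EuclideanSpace ℝ (Fin n) → EuclideanSpace ℝ (Fin n) →L[ℝ] EuclideanSpace ℝ (Fin n)}
    (hM : ∀ y V, IsApproxTangent d E y V → M y = V.starProjection)
    {V : Submodule ℝ (EuclideanSpace ℝ (Fin n))} (hV : Module.finrank ℝ V = d)
    (y : EuclideanSpace ℝ (Fin n)) :
    truncatedTilt M V y ≤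
      ENNReal.ofReal ‖(approxTangent d E y).starProjection - V.starProjection‖ := by
  refine ENNReal.ofReal_le_ofReal ?_
  by_cases h : ∃ W, IsApproxTangent d E y W
  · rw [approxTangent, dif_pos h, hM y _ h.choose_spec]
    exact min_le_right _ _
  · -- here `T(y)` is the junk value `⊥`, at distance one from every nontrivial plane
    have hne : V ≠ ⊥ := by
      rintro rfl
      simp at hV
      omega
    rw [approxTangent, dif_neg h, Submodule.starProjection_bot, zero_sub, norm_neg,
      Submodule.norm_starProjection _ hne]
    exact min_le_left _ _

lemma ofReal_min_norm_le_truncatedTilt_add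
    (M : EuclideanSpace ℝ (Fin n) → EuclideanSpace ℝ (Fin n) →L[ℝ] EuclideanSpace ℝ (Fin n))
    (V W : Submodule ℝ (EuclideanSpace ℝ (Fin n))) (y : EuclideanSpace ℝ (Fin n)) :
    ENNReal.ofReal (min 1 ‖V.starProjection - W.starProjection‖) ≤
      truncatedTilt M V y + truncatedTilt M W y := by
  rw [truncatedTilt, truncatedTilt, ← ENNReal.ofReal_add (by positivity) (by positivity)]
  refine ENNReal.ofReal_le_ofReal ?_
  have h := norm_sub_le_norm_sub_add_norm_sub V.starProjection (M y) W.starProjection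
  rw [norm_sub_rev _ (M y)] at h
  rcases le_total 1 ‖M y - V.starProjection‖ with h1 | h1 <;>
  rcases le_total 1 ‖M y - W.starProjection‖ with h2 | h2 <;>
  simp only [min_eq_left, min_eq_right, h1, h2] <;>
  [skip; skip; skip; exact (min_le_right _ _).trans h] <;>
  refine (min_le_left _ _).trans ?_ <;>
  linarith [norm_nonneg (M y - V.starProjection), norm_nonneg (M y - W.starProjection)]

lemma exists_plane_of_gamma_le {E : Set (EuclideanSpace ℝ (Fin n))} {δ : ℝ} (hδ : 0 < δ)
    (hγ : gamma d E ≤ ENNReal.ofReal δ) {x : EuclideanSpace ℝ (Fin n)} (hx : x ∈ E) {r : ℝ}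
    (hr : 0 < r) (hfin : (hausdorff d).restrict E (Metric.ball x r) ≠ ∞) :
    ∃ V : Submodule ℝ (EuclideanSpace ℝ (Fin n)), Module.finrank ℝ V = d ∧
      ∫⁻ y in Metric.ball x r,
          ENNReal.ofReal ‖(approxTangent d E y).starProjection - V.starProjection‖
            ∂((hausdorff d).restrict E) ≤
        ENNReal.ofReal (2 * δ) * (hausdorff d).restrict E (Metric.ball x r) ∧
      ∀ y ∈ E ∩ Metric.ball x r, ‖Vᗮ.starProjection (y - x)‖ ≤ 2 * δ * r := by
  have h1 : _ ≤ gamma d E := le_iSup₂_of_le x hx (le_iSup₂_of_le r hr le_rfl)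
  have h2 : ENNReal.ofReal δ < ENNReal.ofReal (2 * δ) :=
    (ENNReal.ofReal_lt_ofReal_iff (by linarith)).2 (by linarith)
  obtain ⟨V, hV⟩ := iInf_lt_iff.1 ((h1.trans hγ).trans_lt h2)
  obtain ⟨hVd, hV⟩ := iInf_lt_iff.1 hV
  refine ⟨V, hVd, ?_, fun y hy => ?_⟩
  · rw [← measure_mul_setLAverage _ hfin, mul_comm]
    gcongr
    exact le_self_add.trans hV.le
  · have h3 : ENNReal.ofReal (‖Vᗮ.starProjection (y - x)‖ / r) ≤ ENNReal.ofReal (2 * δ) :=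
      (le_iSup₂_of_le y hy.symm le_rfl).trans (le_add_self.trans hV.le)
    rw [ENNReal.ofReal_le_ofReal_iff (by linarith), div_le_iff₀ hr] at h3
    exact h3

/-- If `V` is close to the tangent planes of `E` on average over `B(y, ρ)`, it is close to the
plane that `gamma` provides for this ball, and hence to the chords of `E` from `y`. -/
lemma norm_starProjection_orthogonal_le (hd : 0 < d) {E : Set (EuclideanSpace ℝ (Fin n))}
    {M : EuclideanSpace ℝ (Fin n) → EuclideanSpace ℝ (Fin n) →L[ℝ] EuclideanSpace ℝ (Fin n)}
    (hMm : Measurable M) (hM : ∀ y V, IsApproxTangent d E y V → M y = V.starProjection)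
    {s : ℝ} (hs : 0 < s) (hs3 : 3 * s < 1) (hγ : gamma d E ≤ ENNReal.ofReal (s ^ 2))
    {V : Submodule ℝ (EuclideanSpace ℝ (Fin n))}
    {y : EuclideanSpace ℝ (Fin n)} (hy : y ∈ E) {ρ : ℝ} (hρ : 0 < ρ)
    (hpos : (hausdorff d).restrict E (Metric.ball y ρ) ≠ 0)
    (hfin : (hausdorff d).restrict E (Metric.ball y ρ) ≠ ∞)
    (hgood : ∫⁻ z in Metric.ball y ρ, truncatedTilt M V z ∂((hausdorff d).restrict E) ≤
      ENNReal.ofReal s * (hausdorff d).restrict E (Metric.ball y ρ))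
    {z : EuclideanSpace ℝ (Fin n)} (hz : z ∈ E) (hzy : z ∈ Metric.ball y ρ) :
    ‖Vᗮ.starProjection (z - y)‖ ≤ 2 * s ^ 2 * ρ + 3 * s * ‖z - y‖ := by
  set μ := (hausdorff d).restrict E
  obtain ⟨W, hWd, hWt, hWf⟩ := exists_plane_of_gamma_le (by positivity) hγ hy hρ hfin
  have h1 : ENNReal.ofReal (min 1 ‖V.starProjection - W.starProjection‖) * μ (Metric.ball y ρ) ≤
      ENNReal.ofReal (s + 2 * s ^ 2) * μ (Metric.ball y ρ) := by
    rw [← setLIntegral_const, ENNReal.ofReal_add hs.le (by positivity), add_mul]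
    calc _ ≤ ∫⁻ z in Metric.ball y ρ, (truncatedTilt M V z + truncatedTilt M W z) ∂μ :=
          lintegral_mono fun z => ofReal_min_norm_le_truncatedTilt_add M V W z
      _ = ∫⁻ z in Metric.ball y ρ, truncatedTilt M V z ∂μ +
            ∫⁻ z in Metric.ball y ρ, truncatedTilt M W z ∂μ :=
          lintegral_add_left (measurable_truncatedTilt hMm V) _
      _ ≤ _ := add_le_add hgood
          ((lintegral_mono fun z => truncatedTilt_le hd hM hWd z).trans hWt)
  have h2 : min 1 ‖V.starProjection - W.starProjection‖ ≤ s + 2 * s ^ 2 :=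
    (ENNReal.ofReal_le_ofReal_iff (by positivity)).1
      ((ENNReal.mul_le_mul_iff_left hpos hfin).1 h1)
  have h3 : ‖V.starProjection - W.starProjection‖ ≤ 3 * s := by
    rcases min_le_iff.1 h2 with h | h <;> nlinarith
  have h4 : Vᗮ.starProjection (z - y) = Wᗮ.starProjection (z - y) -
      (V.starProjection - W.starProjection) (z - y) := by
    rw [Submodule.starProjection_orthogonal, Submodule.starProjection_orthogonal]
    simp only [sub_apply]; abel
  rw [h4]
  refine (norm_sub_le _ _).trans (add_le_add (hWf z ⟨hz, hzy⟩) ?_)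
  exact (ContinuousLinearMap.le_opNorm _ _).trans (by gcongr)

/-! ### Chords of a set with small `gamma` -/

lemma IsUpperAhlforsRegular.sigmaFinite {C : ℝ} {E : Set (EuclideanSpace ℝ (Fin n))}
    (hup : IsUpperAhlforsRegular d C E) {x : EuclideanSpace ℝ (Fin n)} (hx : x ∈ E) :
    SigmaFinite ((hausdorff d).restrict E) :=
  ⟨⟨{ set := fun k : ℕ => Metric.ball x (k + 1)
      set_mem := fun _ => trivial
      finite := fun k => (hup x hx _ (by positivity)).trans_lt ENNReal.ofReal_lt_top
      spanning := by
        refine eq_univ_of_forall fun y => mem_iUnion.2 ?_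
        obtain ⟨k, hk⟩ := exists_nat_gt (dist y x)
        exact ⟨k, Metric.mem_ball.2 (by linarith)⟩ }⟩⟩

lemma IsUpperAhlforsRegular.measure_ball_mul_le {C c s : ℝ} (hC : 0 < C) (hc : 0 < c)
    (hs1 : s ^ 2 ≤ 1) {E : Set (EuclideanSpace ℝ (Fin n))} (hup : IsUpperAhlforsRegular d C E)
    (hlow : IsLowerAhlforsRegular d (1 + s ^ 2) E) {y : EuclideanSpace ℝ (Fin n)} (hy : y ∈ E)
    {ρ : ℝ} (hρ : 0 < ρ) :
    (hausdorff d).restrict E (Metric.ball y (c * ρ)) ≤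
      ENNReal.ofReal (2 * c ^ d * C) * (hausdorff d).restrict E (Metric.ball y ρ) := by
  have h2 : (1 : ℝ) / 2 ≤ (1 + s ^ 2)⁻¹ := by
    rw [one_div]
    exact inv_anti₀ (by positivity) (by linarith)
  calc _ ≤ ENNReal.ofReal (C * (c * ρ) ^ d) := hup y hy _ (by positivity)
    _ ≤ ENNReal.ofReal (2 * c ^ d * C * ((1 + s ^ 2)⁻¹ * ρ ^ d)) := by
        refine ENNReal.ofReal_le_ofReal ?_
        calc C * (c * ρ) ^ d = 2 * c ^ d * C * (1 / 2 * ρ ^ d) := by rw [mul_pow]; ring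
          _ ≤ _ := by gcongr
    _ ≤ _ := by
        rw [ENNReal.ofReal_mul (by positivity)]
        gcongr
        exact hlow y hy ρ hρ

/-- In every ball there is a plane `V` such that, off a subset of small measure, all chords of `E`
are nearly parallel to `V`. The exceptional set is where the maximal function of the tilt with
respect to `V` exceeds `s`, the square root of the bound for `gamma`. -/
lemma exists_plane_chords (hd : 0 < d) {C s : ℝ} (hC : 0 < C) (hs : 0 < s) (hs3 : 3 * s < 1)
    {E : Set (EuclideanSpace ℝ (Fin n))} (hE : IsClosed E)
    (hlow : IsLowerAhlforsRegular d (1 + s ^ 2) E) (hup : IsUpperAhlforsRegular d C E)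
    (hγ : gamma d E ≤ ENNReal.ofReal (s ^ 2)) {x : EuclideanSpace ℝ (Fin n)} (hx : x ∈ E)
    {r : ℝ} (hr : 0 < r) :
    ∃ (V : Submodule ℝ (EuclideanSpace ℝ (Fin n))) (F : Set (EuclideanSpace ℝ (Fin n))),
      Module.finrank ℝ V = d ∧ F ⊆ E ∩ Metric.ball x r ∧
      (∀ y ∈ F, ∀ z ∈ F, ‖Vᗮ.starProjection (z - y)‖ ≤ 7 * s * ‖z - y‖) ∧
      (hausdorff d).restrict E (Metric.ball x r \ F) ≤
        ENNReal.ofReal (4 * 4 ^ d * 6 ^ d * C ^ 2 * s * r ^ d) := by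
  have := hup.sigmaFinite hx
  obtain ⟨M, hMm, hM⟩ := exists_measurable_eq_starProjection hd E
  set μ := (hausdorff d).restrict E with hμ
  have hfin {y} (hy : y ∈ E) {ρ : ℝ} (hρ : 0 < ρ) : μ (Metric.ball y ρ) ≠ ∞ :=
    ((hup y hy ρ hρ).trans_lt ENNReal.ofReal_lt_top).ne
  have hpos {y} (hy : y ∈ E) {ρ : ℝ} (hρ : 0 < ρ) : μ (Metric.ball y ρ) ≠ 0 :=
    ((ENNReal.ofReal_pos.2 (by positivity)).trans_le (hlow y hy ρ hρ)).ne'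
  -- chords of `B(x, r)` have length below `2 r`; the ball about one endpoint of twice that radius
  -- lies in `B(x, 6 r)`
  obtain ⟨V, hVd, hV, -⟩ := exists_plane_of_gamma_le (by positivity) hγ hx
    (by positivity : 0 < 6 * r) (hfin hx (by positivity))
  let S := {y ∈ E ∩ Metric.ball x r | ∃ ρ, 0 < ρ ∧ ρ ≤ 5 * r ∧ Metric.ball y ρ ⊆
    Metric.ball x (6 * r) ∧ ENNReal.ofReal s * μ (Metric.ball y ρ) ≤
      ∫⁻ z in Metric.ball y ρ, truncatedTilt M V z ∂μ}
  have hS : μ S ≤ ENNReal.ofReal (4 * 4 ^ d * 6 ^ d * C ^ 2 * s * r ^ d) := by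
    have h1 : ENNReal.ofReal s * μ S ≤ ENNReal.ofReal (2 * 4 ^ d * C) *
        ∫⁻ z in Metric.ball x (6 * r), truncatedTilt M V z ∂μ :=
      mul_measure_le_of_forall_exists_ball
        (fun y hy ρ hρ => hup.measure_ball_mul_le hC (by norm_num) (by nlinarith) hlow hy.1.1 hρ)
        fun y hy => hy.2
    have h2 : ∫⁻ z in Metric.ball x (6 * r), truncatedTilt M V z ∂μ ≤
        ENNReal.ofReal (2 * s ^ 2) * ENNReal.ofReal (C * (6 * r) ^ d) :=
      ((lintegral_mono fun z => truncatedTilt_le hd hM hVd z).trans hV).trans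
        (by gcongr; exact hup x hx _ (by positivity))
    have h3 : ENNReal.ofReal s * μ S ≤ ENNReal.ofReal s *
        ENNReal.ofReal (4 * 4 ^ d * 6 ^ d * C ^ 2 * s * r ^ d) := by
      refine (h1.trans (mul_le_mul_right h2 _)).trans_eq ?_
      rw [← ENNReal.ofReal_mul (by positivity), ← ENNReal.ofReal_mul (by positivity),
        ← ENNReal.ofReal_mul (by positivity)]
      congr 1
      rw [mul_pow]; ring
    exact (ENNReal.mul_le_mul_iff_right (ENNReal.ofReal_pos.2 hs).ne' ENNReal.ofReal_ne_top).1 h3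
  refine ⟨V, (E ∩ Metric.ball x r) \ S, hVd, sdiff_subset, fun y hy z hz => ?_, ?_⟩
  · rcases eq_or_ne z y with rfl | hzy
    · simp
    have hdist : 0 < ‖z - y‖ := norm_pos_iff.2 (sub_ne_zero.2 hzy)
    have hyx := Metric.mem_ball.1 hy.1.2
    have hzx := Metric.mem_ball.1 hz.1.2
    have hlt : ‖z - y‖ < 2 * r := by
      rw [← dist_eq_norm]
      linarith [dist_triangle_right z y x]
    have hρ : 0 < 2 * ‖z - y‖ := by positivity
    have hgood : ∫⁻ z in Metric.ball y (2 * ‖z - y‖), truncatedTilt M V z ∂μ ≤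
        ENNReal.ofReal s * μ (Metric.ball y (2 * ‖z - y‖)) := by
      by_contra! hbad
      exact hy.2 ⟨hy.1, _, hρ, by linarith, Metric.ball_subset_ball' (by linarith), hbad.le⟩
    have := norm_starProjection_orthogonal_le hd hMm hM hs hs3 hγ hy.1.1 hρ (hpos hy.1.1 hρ)
      (hfin hy.1.1 hρ) hgood hz.1.1 (Metric.mem_ball.2 (by rw [dist_eq_norm]; linarith))
    calc _ ≤ 4 * (s * s) * ‖z - y‖ + 3 * s * ‖z - y‖ := this.trans_eq (by ring)
      _ ≤ 4 * (s * 1) * ‖z - y‖ + 3 * s * ‖z - y‖ := by gcongr; linarith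
      _ = _ := by ring
  · have hsub : Metric.ball x r \ ((E ∩ Metric.ball x r) \ S) ⊆ S ∪ Eᶜ := by
      rintro y ⟨hy, hy'⟩
      by_cases hyE : y ∈ E
      · exact Or.inl (by_contra fun h => hy' ⟨⟨hyE, hy⟩, h⟩)
      · exact Or.inr hyE
    have h0 : μ Eᶜ = 0 := by
      rw [hμ, Measure.restrict_apply hE.measurableSet.compl]; simp
    calc _ ≤ μ S + μ Eᶜ := (measure_mono hsub).trans (measure_union_le _ _)
      _ ≤ _ := by rw [h0, add_zero]; exact hS

/-! ### Comparison with the graph -/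

lemma one_add_pow_le {ε : ℝ} (h0 : 0 ≤ ε) (h1 : ε ≤ 1) (d : ℕ) :
    (1 + ε) ^ d ≤ 1 + 3 ^ d * ε := by
  induction d with
  | zero => simpa using h0
  | succ d ih =>
    have h3 : (1 : ℝ) ≤ 3 ^ d := one_le_pow₀ (by norm_num)
    calc (1 + ε) ^ (d + 1) ≤ (1 + 3 ^ d * ε) * (1 + ε) := by rw [pow_succ]; gcongr
      _ ≤ _ := by rw [pow_succ]; nlinarith [mul_nonneg (by linarith : (0 : ℝ) ≤ 3 ^ d) h0,
                    mul_nonneg (mul_nonneg (by linarith : (0 : ℝ) ≤ 3 ^ d) h0) (sub_nonneg.2 h1)]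

/-- A set that fills nearly as much of a ball as a plane and mostly lies on a set `Γ` of nearly
minimal measure also fills most of `Γ`. -/
lemma measure_symmDiff_le {X : Type*} [MeasurableSpace X] {ν : Measure X} {E Γ : Set X}
    (hE : MeasurableSet E) {l a g : ℝ} (hl : 0 ≤ l) (ha : 0 ≤ a) (hg : 0 ≤ g)
    (h1 : ENNReal.ofReal l ≤ ν E) (h2 : ν (E \ Γ) ≤ ENNReal.ofReal a)
    (h3 : ν Γ ≤ ENNReal.ofReal g) (hgl : l ≤ g + a) :
    ν (E ∆ Γ) ≤ ENNReal.ofReal (2 * a + g - l) := by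
  have h4 : ν (Γ \ E) + ENNReal.ofReal l ≤ ENNReal.ofReal g + ENNReal.ofReal a :=
    calc ν (Γ \ E) + ENNReal.ofReal l ≤ ν (Γ \ E) + (ν (E ∩ Γ) + ν (E \ Γ)) := by
          gcongr
          exact h1.trans (measure_le_inter_add_sdiff ν E Γ)
      _ = (ν (Γ ∩ E) + ν (Γ \ E)) + ν (E \ Γ) := by rw [inter_comm]; ring
      _ ≤ _ := by rw [measure_inter_add_sdiff Γ hE]; gcongr
  have h5 : ν (Γ \ E) ≤ ENNReal.ofReal (g + a - l) := by
    rw [ENNReal.ofReal_sub _ hl, ENNReal.ofReal_add hg ha]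
    exact ENNReal.le_sub_of_add_le_right ENNReal.ofReal_ne_top h4
  calc ν (E ∆ Γ) ≤ ν (E \ Γ) + ν (Γ \ E) := measure_union_le _ _
    _ ≤ ENNReal.ofReal a + ENNReal.ofReal (g + a - l) := add_le_add h2 h5
    _ = _ := by rw [← ENNReal.ofReal_add ha (by linarith)]; ring_nf

end SmallUR

theorem mainTheorem6 (n d : ℕ) (hd : 0 < d) (hdn : d < n) (C_E : ℝ) (hC_E : 0 < C_E) :
    ∃ δ₀ C₀ : ℝ, 0 < δ₀ ∧ 0 < C₀ ∧
      ∀ (δ : ℝ) (E : Set (EuclideanSpace ℝ (Fin n))),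
        0 < δ → δ < δ₀ → IsClosed E → SmallUR.IsRectifiable d E →
        SmallUR.IsLowerAhlforsRegular d (1 + δ) E → SmallUR.IsUpperAhlforsRegular d C_E E →
        SmallUR.gamma d E ≤ ENNReal.ofReal δ →
        SmallUR.IsSmallUR d (C₀ * δ ^ ((1 : ℝ) / 2)) E := by
  obtain ⟨K, hK, hgraph⟩ := SmallUR.exists_subset_range_graph n
  -- `B * s * r ^ d` bounds the exceptional set, `7 * K * s` the Lipschitz constant of the graph
  set B : ℝ := 4 * 4 ^ d * 6 ^ d * C_E ^ 2 with hB
  have hB0 : 0 < B := by positivity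
  have h2d : (1 : ℝ) ≤ 2 ^ d := one_le_pow₀ (by norm_num)
  set C₀ : ℝ := 4 * 2 ^ d * B + 3 ^ d * (7 * K) + 7 * K + 1 with hC₀
  have hC0 : 0 < C₀ := by positivity
  have hBC : 4 * 2 ^ d * B ≤ C₀ := by
    have : 0 < 3 ^ d * (7 * K) + 7 * K + 1 := by positivity
    linarith
  have hKC : 7 * K ≤ C₀ := by
    have : 0 < 4 * 2 ^ d * B + 3 ^ d * (7 * K) + 1 := by positivity
    linarith
  -- this `δ₀` makes `C₀ * s < 1 / 10` for `s = √δ`; as `C₀` exceeds `7 * K` and `4 * 2 ^ d * B`,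
  -- all other smallness conditions on `s` follow
  refine ⟨(1 / (10 * C₀)) ^ 2, C₀, by positivity, hC0, ?_⟩
  intro δ E hδ hδ0 hE _ hlow hup hγ
  obtain ⟨s, hs, rfl⟩ : ∃ s : ℝ, 0 < s ∧ s ^ 2 = δ :=
    ⟨√δ, Real.sqrt_pos.2 hδ, Real.sq_sqrt hδ.le⟩
  rw [← Real.sqrt_eq_rpow, Real.sqrt_sq hs.le]
  have hs0 : C₀ * s < 1 / 10 := by
    have := lt_of_pow_lt_pow_left₀ 2 (by positivity) hδ0
    rw [lt_div_iff₀ (by positivity)] at this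
    linarith
  have hKs : 7 * K * s < 1 / 10 := (mul_le_mul_of_nonneg_right hKC hs.le).trans_lt hs0
  have hBs : 4 * 2 ^ d * B * s < 1 / 10 := (mul_le_mul_of_nonneg_right hBC hs.le).trans_lt hs0
  have h7s : 7 * s < 1 / 10 := by nlinarith
  have hinv : 1 - s ^ 2 ≤ (1 + s ^ 2)⁻¹ := by
    rw [← one_div, le_div_iff₀ (by positivity)]
    nlinarith [sq_nonneg (s ^ 2)]
  refine ⟨hE, by positivity, hs0, fun x hx r hr => ?_⟩
  obtain ⟨V, F, hVd, -, hF, hbad⟩ :=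
    SmallUR.exists_plane_chords hd hC_E hs (by linarith) hE hlow hup hγ hx hr
  rw [← hB] at hbad
  obtain ⟨A, hA, hFA⟩ := hgraph V F (7 * s) (by positivity) (by linarith) hF
  set Γ := range fun v : V => (v : EuclideanSpace ℝ (Fin n)) + (A v : EuclideanSpace ℝ (Fin n))
  have hrd : 0 < r ^ d := by positivity
  refine ⟨Γ, ⟨V, hVd, A, fun v w => (hA v w).trans ?_, rfl⟩, ?_, ?_⟩
  · rw [show K * (7 * s) = 7 * K * s by ring]
    gcongr
  · have hε : 0 ≤ K * (7 * s) := by positivity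
    have hpow := SmallUR.one_add_pow_le hε (by linarith) d
    have hl : (1 - s ^ 2) * r ^ d ≤ (1 + s ^ 2)⁻¹ * r ^ d := by gcongr
    have hg := mul_le_mul_of_nonneg_right hpow hrd.le
    have hl1 : (1 + s ^ 2)⁻¹ * r ^ d ≤ (1 + K * (7 * s)) ^ d * r ^ d := by
      gcongr
      exact (inv_le_one_of_one_le₀ (by nlinarith)).trans (one_le_pow₀ (by linarith))
    refine (SmallUR.measure_symmDiff_le hE.measurableSet (l := (1 + s ^ 2)⁻¹ * r ^ d)
      (a := B * s * r ^ d) (g := (1 + K * (7 * s)) ^ d * r ^ d) (by positivity) (by positivity)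
      (by positivity) ?_ ?_ ?_ ?_).trans (ENNReal.ofReal_le_ofReal ?_)
    · rw [Measure.restrict_apply hE.measurableSet, inter_comm,
        ← Measure.restrict_apply measurableSet_ball]
      exact hlow x hx r hr
    · refine le_trans ?_ hbad
      rw [Measure.restrict_apply' measurableSet_ball, Measure.restrict_apply' hE.measurableSet]
      exact measure_mono fun y hy => ⟨⟨hy.2, fun h => hy.1.2 (hFA h)⟩, hy.1.1⟩
    · rw [Measure.restrict_apply' measurableSet_ball]
      exact SmallUR.hausdorff_graph_inter_ball_le hVd hε hA x hr
    · have : 0 < B * s * r ^ d := by positivity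
      linarith
    · have hcoef : 2 * (B * s) + 3 ^ d * (K * (7 * s)) + s ^ 2 ≤ C₀ * s := by
        have : C₀ * s = 4 * 2 ^ d * B * s + 3 ^ d * (K * (7 * s)) + 7 * K * s + s := by
          rw [hC₀]; ring
        have h1 : 2 * (B * s) ≤ 4 * 2 ^ d * B * s := by
          have : 0 < B * s := by positivity
          nlinarith
        have h2 : s ^ 2 ≤ s := by nlinarith
        have h3 : 0 ≤ 7 * K * s := by positivity
        linarith
      have := mul_le_mul_of_nonneg_right hcoef hrd.le
      nlinarith
  · -- `F` meets `B(x, r / 2)`, because `E` has more mass there than the exceptional set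
    by_contra hne
    rw [not_nonempty_iff_eq_empty] at hne
    have hr2 : Metric.ball x (r / 2) ⊆ Metric.ball x r := Metric.ball_subset_ball (by linarith)
    have hsub : Metric.ball x (r / 2) ⊆ Metric.ball x r \ F := fun y hy =>
      ⟨hr2 hy, fun h => by
        have : y ∈ Γ ∩ Metric.ball x (r / 2) := ⟨hFA h, hy⟩
        rw [hne] at this
        exact this⟩
    have h1 := ((hlow x hx (r / 2) (by positivity)).trans (measure_mono hsub)).trans hbad
    rw [ENNReal.ofReal_le_ofReal_iff (by positivity), div_pow, ← mul_div_assoc,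
      div_le_iff₀ (by positivity)] at h1
    have h2 : (1 - s ^ 2) * r ^ d ≤ (B * s * 2 ^ d) * r ^ d := by
      have : (1 - s ^ 2) * r ^ d ≤ (1 + s ^ 2)⁻¹ * r ^ d := by gcongr
      linarith
    have h3 := le_of_mul_le_mul_right h2 hrd
    nlinarith
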